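/- Let $n\ge 2$ be an integer. Call a monic polynomial $f=x^n+a_{n-1}x^{n-1}+\dots+a_0\in\mathbb{Z}[x]$ Eisenstein if there is a prime $p$ with $p\mid a_i$ for $0\le i\le n-1$ and $p^2\nmid a_0$; such an $f$ is irreducible over $\mathbb{Q}$ and generates the number field $K_f=\mathbb{Q}[x]/(f)$. Let $\mathrm{Ht}(f)=\max\{1,|a_0|,\dots,|a_{n-1}|\}$ be the height of $f$. A number field $K$ with ring of integers $\mathcal{O}_K$ and norm $N:K\to\mathbb{Q}$ is norm-Euclidean if for all $\alpha,\beta\in\mathcal{O}_K$ with $\beta\ne 0$ there are $\gamma,\rho\in\mathcal{O}_K$ with $\alpha=\gamma\beta+\rho$ and $|N(\rho)|<|N(\beta)|$. Then a positive proportion of the monic Eisenstein polynomials of degree $n$, ordered by height, generate number fields that are not norm-Euclidean: $$ \liminf_{X\to\infty}\frac{\#\{f\in\mathbb{Z}[x] \text{ monic Eisenstein of degree } n \mid \mathrm{Ht}(f)\le X,\ K_f \text{ is not norm-Euclidean}\}}{\#\{f\in\mathbb{Z}[x] \text{ monic Eisenstein of degree } n \mid \mathrm{Ht}(f)\le X\}}>0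 . $$ -/

import Mathlib

open Polynomial Filter
open scoped NumberField

/-- A number field `K` is norm-Euclidean if for all `α, β ∈ 𝓞 K` with `β ≠ 0` there are
`γ, ρ ∈ 𝓞 K` with `α = γ * β + ρ` and `|N(ρ)| < |N(β)|`, where `N : K → ℚ` is the norm. -/
def NormEuclidean (K : Type*) [Field K] [NumberField K] : Prop :=
  ∀ α β : 𝓞 K, β ≠ 0 →
    ∃ γ ρ : 𝓞 K, α = γ * β + ρ ∧
      |Algebra.norm ℚ (ρ : K)| < |Algebra.norm ℚ (β : K)|

/-- `f` generates a number field `ℚ[x]/(f)` (that is, `f` is irreducible over `ℚ`), and that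
number field is not norm-Euclidean. -/
def GeneratesNonNormEuclideanField (f : ℤ[X]) : Prop :=
  ∃ h : Irreducible (f.map (Int.castRingHom ℚ)),
    haveI : Fact (Irreducible (f.map (Int.castRingHom ℚ))) := ⟨h⟩
    ¬ NormEuclidean (AdjoinRoot (f.map (Int.castRingHom ℚ)))

/-- `f` is Eisenstein at some prime number `p`. -/
def IsEisensteinPoly (f : ℤ[X]) : Prop :=
  ∃ p : ℕ, p.Prime ∧ f.IsEisensteinAt (Ideal.span {(p : ℤ)})

/-- The monic Eisenstein polynomials of degree `n` with integer coefficients. -/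
def monicEisenstein (n : ℕ) : Set ℤ[X] :=
  {f | f.Monic ∧ f.natDegree = n ∧ IsEisensteinPoly f}

/-- The number of `f ∈ F` of height at most `X`, where the height of
`f = aₙ xⁿ + ⋯ + a₁ x + a₀` is `f.supNorm = max {|a₀|, …, |aₙ|}`. -/
noncomputable def countHeightLE (F : Set ℤ[X]) (X : ℝ) : ℕ :=
  {f : ℤ[X] | f ∈ F ∧ f.supNorm ≤ X}.ncard

/-- The proportion of the elements of `F` of height at most `X` which have the property `P`. -/
noncomputable def proportionHeightLE (F : Set ℤ[X]) (P : ℤ[X] → Prop) (X : ℝ) : ℝ :=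
  (countHeightLE {f | f ∈ F ∧ P f} X : ℝ) / (countHeightLE F X : ℝ)

/-- The lower density in `F`, with respect to the height, of the polynomials with
the property `P`. -/
noncomputable def lowerDensity (F : Set ℤ[X]) (P : ℤ[X] → Prop) : ℝ :=
  liminf (proportionHeightLE F P) atTop

/-! ### Norms modulo ramified and inert primes. -/

section Norms

variable {S : Type*} [CommRing S] [Module.Free ℤ S] [Module.Finite ℤ S]

/-! Let `f` be Eisenstein at `p`, so that `p` is totally ramified in `K_f`, and suppose the field is
norm-Euclidean. The prime above `p` is then `(π)` with `|N π| ≤ p`. Dividing an integer `c` by `π`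
leaves a remainder `ρ` with `N ρ ≡ c ^ n` modulo `p` and `|N ρ| < p`
(`NormEuclidean.exists_norm_modEq_pow`). If `c ^ n ≡ r` and `p = r + s` with `r, s > 0`, then `N ρ`
is `r` or `-s`. An inert prime occurs in every norm with exponent divisible by `n`, so both values
are excluded once `2` and `q` are inert, `n ∤ v_2(r)` and `n ∤ v_q(s)`.

Such `p, q, r, s` exist for every `n ≥ 2` (`exists_prime_eq_add_not_dvd_factorization`). The
remaining conditions are congruences on the coefficients: Eisenstein modulo `p ^ 2`, irreducible
modulo `2` and modulo `q`. They hold on a whole residue class, which has positive density. -/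

/-- If a power of `y` is divisible by the prime `p`, then `N(c - y) ≡ N(c)` modulo `p`. -/
theorem dvd_norm_intCast_sub_of_dvd_pow {p : ℕ} (hp : p.Prime) (c : ℤ) {y : S} {k : ℕ}
    (hy : (p : S) ∣ y ^ k) :
    (p : ℤ) ∣ Algebra.norm ℤ ((c : S) - y) - c ^ Module.finrank ℤ S := by
  classical
  have := Fact.mk hp
  let b := Module.Free.chooseBasis ℤ S
  let M := Algebra.leftMulMatrix b y
  -- The norm is the characteristic polynomial of multiplication by `y`, evaluated at `c`. Modulo
  -- `p` that matrix is nilpotent, so the polynomial becomes a pure power of `X`.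
  have hdet : Algebra.norm ℤ ((c : S) - y) = M.charpoly.eval c := by
    rw [Algebra.norm_eq_matrix_det b, Matrix.eval_charpoly, map_sub]
    congr 2
    have : ((c : ℤ) : S) = algebraMap ℤ S c := by simp
    rw [this, AlgHom.commutes, Matrix.algebraMap_eq_diagonal]
    rfl
  let φ := Int.castRingHom (ZMod p)
  have hnil : IsNilpotent (M.map φ) := by
    refine ⟨k, ?_⟩
    obtain ⟨z, hz⟩ := hy
    have h1 : M ^ k = (p : Matrix _ _ ℤ) * Algebra.leftMulMatrix b z := by
      rw [← map_pow, hz, map_mul, map_natCast]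
    have h2 : φ.mapMatrix M ^ k = 0 := by
      rw [← map_pow, h1, map_mul, map_natCast]
      ext i j
      rw [← nsmul_eq_mul]
      simp
    exact h2
  have hchar : (M.map φ).charpoly = X ^ Module.finrank ℤ S := by
    have := Matrix.isNilpotent_charpoly_sub_pow_of_isNilpotent hnil
    rw [isNilpotent_iff_eq_zero, sub_eq_zero] at this
    rw [this, Module.finrank_eq_card_basis b]
  have h := Matrix.charpoly_map M φ
  rw [hchar] at h
  have h2 : φ (M.charpoly.eval c) = φ (c ^ Module.finrank ℤ S) := by
    have := congrArg (Polynomial.eval (φ c)) h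
    rw [Polynomial.eval_map, Polynomial.eval₂_at_apply] at this
    simpa using this.symm
  rw [hdet, ← ZMod.intCast_zmod_eq_zero_iff_dvd]
  have h3 : φ (M.charpoly.eval c - c ^ Module.finrank ℤ S) = 0 := by rw [map_sub, h2, sub_self]
  simpa using h3

/-- If a prime `q` generates a maximal ideal, then the elements of norm divisible by `q` are
divisible by `q`. -/
theorem dvd_of_dvd_norm_of_isMaximal {q : ℕ} (hq : q.Prime)
    (hmax : (Ideal.span {(q : S)}).IsMaximal) {x : S} (hx : (q : ℤ) ∣ Algebra.norm ℤ x) :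
    (q : S) ∣ x := by
  by_contra hdvd
  have hmem : x ∉ Ideal.span {(q : S)} := by rwa [Ideal.mem_span_singleton]
  obtain ⟨y, i, hi, hyx⟩ := hmax.exists_inv hmem
  have hi' : (q : S) ∣ i ^ 1 := by simpa [Ideal.mem_span_singleton] using hi
  -- Since `y * x = 1 - i` with `q ∣ i`, the norm of `y * x` is `1` modulo `q`.
  have h := dvd_norm_intCast_sub_of_dvd_pow hq 1 hi'
  have hxy : ((1 : ℤ) : S) - i = y * x := by push_cast; linear_combination -hyx
  rw [hxy, map_mul, one_pow] at h
  have : (q : ℤ) ∣ 1 := by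
    have := dvd_sub (hx.mul_left (Algebra.norm ℤ y)) h
    simpa using this
  exact hq.one_lt.ne' (by exact_mod_cast Int.eq_one_of_dvd_one (by positivity) this)

/-- If a prime `q` is inert, then the exponent of `q` in norms is divisible by the degree. -/
theorem finrank_dvd_factorization_natAbs_norm {q : ℕ} (hq : q.Prime)
    (hmax : (Ideal.span {(q : S)}).IsMaximal) (x : S) :
    Module.finrank ℤ S ∣ (Algebra.norm ℤ x).natAbs.factorization q := by
  induction hm : (Algebra.norm ℤ x).natAbs.factorization q using Nat.strong_induction_on
    generalizing x with
  | _ m ih =>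
    subst hm
    by_cases h0 : Algebra.norm ℤ x = 0
    · simp [h0]
    by_cases hdvd : (q : ℤ) ∣ Algebra.norm ℤ x
    · obtain ⟨z, rfl⟩ := dvd_of_dvd_norm_of_isMaximal hq hmax hdvd
      have hz : (Algebra.norm ℤ z) ≠ 0 := fun h => h0 (by rw [map_mul, h, mul_zero])
      have hfac : (Algebra.norm ℤ ((q : S) * z)).natAbs.factorization q =
          Module.finrank ℤ S + (Algebra.norm ℤ z).natAbs.factorization q := by
        rw [map_mul, Algebra.norm_natCast, Int.natAbs_mul, Int.natAbs_pow, Int.natAbs_natCast,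
          Nat.factorization_mul (pow_ne_zero _ hq.ne_zero) (by simpa using hz)]
        simp [hq.factorization_self]
      -- Removing a factor `q` lowers the exponent by the rank, so the induction needs positive
      -- rank; in rank `0` all norms are `1`.
      rcases Nat.eq_zero_or_pos (Module.finrank ℤ S) with hn | hn
      · rw [map_mul, Algebra.norm_natCast, hn, pow_zero, one_mul] at hdvd
        have : Subsingleton S := Module.finrank_zero_iff.mp hn
        rw [Subsingleton.elim z 1, map_one] at hdvd
        exact absurd (by exact_mod_cast Int.eq_one_of_dvd_one (by positivity) hdvd) hq.one_lt.ne'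
      rw [hfac]
      exact (Nat.dvd_add_right dvd_rfl).mpr (ih _ (by rw [hfac]; omega) z rfl)
    · rw [Nat.factorization_eq_zero_of_not_dvd (by rwa [← Int.natCast_dvd])]
      exact dvd_zero _

end Norms

/-- A prime `q` is inert in an order of rank `n` which contains a root of a polynomial of degree
`n` that is irreducible modulo `q`. -/
theorem isMaximal_span_natCast_of_irreducible_map {S : Type*} [CommRing S] [IsDedekindDomain S]
    [Module.Free ℤ S] [Module.Finite ℤ S] {q : ℕ} (hq : q.Prime) {f : ℤ[X]} (hf : f.Monic)
    (hdeg : f.natDegree = Module.finrank ℤ S)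
    (hirr : Irreducible (f.map (Int.castRingHom (ZMod q)))) {θ : S} (hθ : aeval θ f = 0) :
    (Ideal.span {(q : S)}).IsMaximal := by
  have := Fact.mk hq
  have := Fact.mk hirr
  set I := Ideal.span {(q : S)} with hI
  have hdeg' : (f.map (Int.castRingHom (ZMod q))).natDegree = Module.finrank ℤ S := by
    rw [hf.natDegree_map, hdeg]
  have hn : 0 < Module.finrank ℤ S := hdeg' ▸ hirr.natDegree_pos
  have hcard : Nat.card (S ⧸ I) = q ^ Module.finrank ℤ S :=
    (Ideal.absNorm_span_natCast q : Ideal.absNorm I = _)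
  have : Finite (S ⧸ I) := Nat.finite_of_card_ne_zero (by rw [hcard]; exact pow_ne_zero _ hq.ne_zero)
  have : Nontrivial (S ⧸ I) := by
    rw [← Finite.one_lt_card_iff_nontrivial, hcard]
    exact Nat.one_lt_pow hn.ne' hq.one_lt
  have hq0 : (q : S ⧸ I) = 0 := by
    have : Ideal.Quotient.mk I (q : S) = 0 :=
      Ideal.Quotient.eq_zero_iff_mem.mpr (Ideal.mem_span_singleton_self _)
    simpa using this
  let ι : ZMod q →+* S ⧸ I := ZMod.castHom (ringChar.dvd hq0) (S ⧸ I)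
  let ψ : AdjoinRoot (f.map (Int.castRingHom (ZMod q))) →+* S ⧸ I :=
    AdjoinRoot.lift ι (Ideal.Quotient.mk I θ) (by
      rw [Polynomial.eval₂_map, RingHom.ext_int (ι.comp _) ((Ideal.Quotient.mk I).comp
        (algebraMap ℤ S)), ← Polynomial.hom_eval₂]
      rw [aeval_def] at hθ
      rw [hθ, map_zero])
  have : Module.Finite (ZMod q) (AdjoinRoot (f.map (Int.castRingHom (ZMod q)))) :=
    (hf.map _).finite_adjoinRoot
  have : Finite (AdjoinRoot (f.map (Int.castRingHom (ZMod q)))) := Module.finite_of_finite (ZMod q)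
  have hcard' : Nat.card (AdjoinRoot (f.map (Int.castRingHom (ZMod q)))) =
      q ^ Module.finrank ℤ S := by
    rw [Module.natCard_eq_pow_finrank (K := ZMod q), Nat.card_zmod,
      (AdjoinRoot.powerBasis' (hf.map _)).finrank, AdjoinRoot.powerBasis'_dim, hdeg']
  -- A ring map out of a field is injective, and both sides have `q ^ n` elements.
  have hbij : Function.Bijective ψ :=
    (Nat.bijective_iff_injective_and_card ψ).mpr ⟨ψ.injective, by rw [hcard, hcard']⟩
  exact Ideal.Quotient.maximal_of_isField _
    ((RingEquiv.ofBijective ψ hbij).symm.toMulEquiv.isField (Field.toIsField _))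

/-! ### Totally ramified primes in norm-Euclidean fields. -/

section NormEuclidean

variable {K : Type*} [Field K] [NumberField K]

/-- The norm-Euclidean property in terms of the integer valued norm. -/
theorem NormEuclidean.exists_eq_mul_add (h : NormEuclidean K) (α : 𝓞 K) {β : 𝓞 K} (hβ : β ≠ 0) :
    ∃ γ ρ : 𝓞 K, α = γ * β + ρ ∧ |Algebra.norm ℤ ρ| < |Algebra.norm ℤ β| := by
  obtain ⟨γ, ρ, h1, h2⟩ := h α β hβ
  refine ⟨γ, ρ, h1, ?_⟩
  rw [← Algebra.coe_norm_int, ← Algebra.coe_norm_int] at h2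
  exact_mod_cast h2

/-- Every nonzero ideal of a norm-Euclidean ring of integers is principal. -/
theorem NormEuclidean.exists_eq_span_singleton (h : NormEuclidean K) {I : Ideal (𝓞 K)}
    (hI : I ≠ ⊥) : ∃ π : 𝓞 K, π ≠ 0 ∧ I = Ideal.span {π} := by
  obtain ⟨x, hxI, hx0⟩ := Submodule.exists_mem_ne_zero_of_ne_bot hI
  obtain ⟨π, ⟨hπI, hπ0⟩, hmin⟩ := WellFounded.has_min
    (measure fun z : 𝓞 K => (Algebra.norm ℤ z).natAbs).wf {z | z ∈ I ∧ z ≠ 0} ⟨x, hxI, hx0⟩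
  refine ⟨π, hπ0, le_antisymm (fun z hz => ?_) ?_⟩
  · obtain ⟨γ, ρ, rfl, hlt⟩ := h.exists_eq_mul_add z hπ0
    have hρI : ρ ∈ I := by
      have := I.sub_mem hz (I.mul_mem_left γ hπI)
      rwa [add_sub_cancel_left] at this
    have hρ0 : ρ = 0 := by
      by_contra hρ
      refine hmin ρ ⟨hρI, hρ⟩ ?_
      change (Algebra.norm ℤ ρ).natAbs < (Algebra.norm ℤ π).natAbs
      rwa [Int.abs_eq_natAbs, Int.abs_eq_natAbs, Nat.cast_lt] at hlt
    rw [hρ0, add_zero, Ideal.mem_span_singleton]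
    exact dvd_mul_left _ _
  · rwa [Ideal.span_singleton_le_iff_mem]

/-- If `p` is totally ramified in a norm-Euclidean field of degree `n`, then each `n`-th power is
congruent modulo `p` to a norm of absolute value less than `p`. -/
theorem NormEuclidean.exists_norm_modEq_pow (h : NormEuclidean K) {p : ℕ} (hp : p.Prime)
    {θ : 𝓞 K} {k : ℕ} (hθ : (p : 𝓞 K) ∣ θ ^ k) (hN : ¬ (p : ℤ) ^ 2 ∣ Algebra.norm ℤ θ) (c : ℤ) :
    ∃ ρ : 𝓞 K, (p : ℤ) ∣ Algebra.norm ℤ ρ - c ^ Module.finrank ℤ (𝓞 K) ∧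
      |Algebra.norm ℤ ρ| < p := by
  have hp0 : (p : 𝓞 K) ≠ 0 := by exact_mod_cast hp.ne_zero
  have hI : Ideal.span {(p : 𝓞 K), θ} ≠ ⊥ := fun hbot => hp0 <| by
    have : (p : 𝓞 K) ∈ Ideal.span {(p : 𝓞 K), θ} := Ideal.subset_span (by simp)
    rwa [hbot, Ideal.mem_bot] at this
  obtain ⟨π, hπ0, hspan⟩ := h.exists_eq_span_singleton hI
  have hπp : π ∣ (p : 𝓞 K) := by
    rw [← Ideal.mem_span_singleton, ← hspan]; exact Ideal.subset_span (by simp)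
  have hπθ : π ∣ θ := by
    rw [← Ideal.mem_span_singleton, ← hspan]; exact Ideal.subset_span (by simp)
  -- Up to sign `N π` is a power of `p`, and it divides `N θ`, which `p ^ 2` does not.
  have hle : |Algebra.norm ℤ π| ≤ p := by
    have h1 : (Algebra.norm ℤ π).natAbs ∣ p ^ Module.finrank ℤ (𝓞 K) := by
      have := map_dvd (Algebra.norm ℤ) hπp
      rw [Algebra.norm_natCast] at this
      simpa [Int.natAbs_pow] using Int.natAbs_dvd_natAbs.mpr this
    obtain ⟨j, -, hj⟩ := (Nat.dvd_prime_pow hp).mp h1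
    have hj1 : j ≤ 1 := by
      by_contra hj2
      refine hN (dvd_trans ?_ (map_dvd (Algebra.norm ℤ) hπθ))
      rw [← Int.dvd_natAbs, hj]
      exact_mod_cast pow_dvd_pow p (by omega)
    rw [Int.abs_eq_natAbs, hj]
    exact_mod_cast (Nat.pow_le_pow_right hp.pos hj1).trans (pow_one p).le
  obtain ⟨γ, ρ, hγρ, hlt⟩ := h.exists_eq_mul_add (c : 𝓞 K) hπ0
  refine ⟨ρ, ?_, hlt.trans_le hle⟩
  have hmem : γ * π ∈ Ideal.span {(p : 𝓞 K), θ} := by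
    rw [hspan]; exact Ideal.mul_mem_left _ _ (Ideal.mem_span_singleton_self π)
  obtain ⟨a, b, hab⟩ := Ideal.mem_span_pair.mp hmem
  -- Modulo `p` the element `γ * π` is a multiple of `θ`, hence nilpotent, so subtracting it from
  -- `c` does not change the norm modulo `p`.
  have hpow : (p : 𝓞 K) ∣ (γ * π) ^ k := by
    have h1 : (p : 𝓞 K) ∣ (γ * π) ^ k - (b * θ) ^ k :=
      dvd_trans ⟨a, by rw [← hab]; ring⟩ (sub_dvd_pow_sub_pow _ _ k)
    have h2 : (p : 𝓞 K) ∣ (b * θ) ^ k := by rw [mul_pow]; exact hθ.mul_left _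
    simpa using dvd_add h1 h2
  have := dvd_norm_intCast_sub_of_dvd_pow hp c hpow
  rwa [hγρ, add_sub_cancel_left] at this

/-- A field of degree `n` in which `p` is totally ramified is not norm-Euclidean if there are
inert primes `q` and `q'` and an `n`-th power residue `r` modulo `p` such that the exponents of `q`
in `r` and of `q'` in `p - r` are not divisible by `n`. -/
theorem not_normEuclidean_of_isMaximal {p : ℕ} (hp : p.Prime)
    {θ : 𝓞 K} {k : ℕ} (hθ : (p : 𝓞 K) ∣ θ ^ k) (hN : ¬ (p : ℤ) ^ 2 ∣ Algebra.norm ℤ θ)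
    {q q' : ℕ} (hq : q.Prime) (hq' : q'.Prime) (hmax : (Ideal.span {(q : 𝓞 K)}).IsMaximal)
    (hmax' : (Ideal.span {(q' : 𝓞 K)}).IsMaximal) {r s : ℕ} (hrs : r + s = p) (hr0 : 0 < r)
    (hs0 : 0 < s) (hr : ¬ Module.finrank ℤ (𝓞 K) ∣ r.factorization q)
    (hs : ¬ Module.finrank ℤ (𝓞 K) ∣ s.factorization q') {c : ℤ}
    (hc : (p : ℤ) ∣ c ^ Module.finrank ℤ (𝓞 K) - r) : ¬ NormEuclidean K := by
  intro h
  obtain ⟨ρ, hρ, hlt⟩ := h.exists_norm_modEq_pow hp hθ hN c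
  have hdvd : (p : ℤ) ∣ Algebra.norm ℤ ρ - r := by simpa using dvd_add hρ hc
  rw [abs_lt] at hlt
  have hcases : Algebra.norm ℤ ρ = r ∨ Algebra.norm ℤ ρ = -s := by
    obtain ⟨t, ht⟩ := hdvd
    have hps : (p : ℤ) = r + s := by exact_mod_cast hrs.symm
    have h1 : t < 1 := by by_contra!; nlinarith
    have h2 : -2 < t := by by_contra!; nlinarith
    obtain rfl | rfl : t = 0 ∨ t = -1 := by omega
    · left; linarith
    · right; linarith
  rcases hcases with h1 | h1
  · have := finrank_dvd_factorization_natAbs_norm hq hmax ρ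
    rw [h1, Int.natAbs_natCast] at this
    exact hr this
  · have := finrank_dvd_factorization_natAbs_norm hq' hmax' ρ
    rw [h1, Int.natAbs_neg, Int.natAbs_natCast] at this
    exact hs this

end NormEuclidean

/-! ### From Eisenstein polynomials to number fields. -/

theorem monic_eisenstein_irreducible_map {f : ℤ[X]} {p : ℕ} (hp : p.Prime) (hf : f.Monic)
    (hE : f.IsEisensteinAt (Ideal.span {(p : ℤ)})) (hdeg : 0 < f.natDegree) :
    Irreducible (f.map (Int.castRingHom ℚ)) :=
  (IsPrimitive.Int.irreducible_iff_irreducible_map_cast hf.isPrimitive).mp <|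
    hE.irreducible ((Ideal.span_singleton_prime (by exact_mod_cast hp.ne_zero)).mpr
      (Nat.prime_iff_prime_int.mp hp)) hf.isPrimitive hdeg

/-- A criterion for an Eisenstein polynomial to generate a field which is not norm-Euclidean. -/
theorem generatesNonNormEuclideanField_of_isEisensteinAt {f : ℤ[X]} (hf : f.Monic)
    (hdeg : 0 < f.natDegree) {p q q' : ℕ} (hp : p.Prime) (hq : q.Prime) (hq' : q'.Prime)
    (hE : f.IsEisensteinAt (Ideal.span {(p : ℤ)}))
    (hirr : Irreducible (f.map (Int.castRingHom (ZMod q))))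
    (hirr' : Irreducible (f.map (Int.castRingHom (ZMod q')))) {r s : ℕ} (hrs : r + s = p)
    (hr0 : 0 < r) (hs0 : 0 < s) (hr : ¬ f.natDegree ∣ r.factorization q)
    (hs : ¬ f.natDegree ∣ s.factorization q') {c : ℤ} (hc : (p : ℤ) ∣ c ^ f.natDegree - r) :
    GeneratesNonNormEuclideanField f := by
  have hQ := monic_eisenstein_irreducible_map hp hf hE hdeg
  refine ⟨hQ, ?_⟩
  have : Fact (Irreducible (f.map (Int.castRingHom ℚ))) := ⟨hQ⟩
  set g := f.map (Int.castRingHom ℚ) with hg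
  have hgm : g.Monic := hf.map _
  have hgdeg : g.natDegree = f.natDegree := hf.natDegree_map _
  have hrank : Module.finrank ℤ (𝓞 (AdjoinRoot g)) = f.natDegree := by
    rw [NumberField.RingOfIntegers.rank, (AdjoinRoot.powerBasis hQ.ne_zero).finrank,
      AdjoinRoot.powerBasis_dim, hgdeg]
  have hroot : aeval (AdjoinRoot.root g) f = 0 := by
    have := AdjoinRoot.eval₂_root g
    rw [hg, Polynomial.eval₂_map] at this
    rw [aeval_def, RingHom.ext_int (algebraMap ℤ (AdjoinRoot g)) ((AdjoinRoot.of g).comp _)]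
    exact this
  let θ : 𝓞 (AdjoinRoot g) := ⟨AdjoinRoot.root g, ⟨f, hf, by rwa [← aeval_def]⟩⟩
  have hθ : aeval θ f = 0 := by
    apply NumberField.RingOfIntegers.coe_injective
    rw [map_zero, ← hroot]
    exact (Polynomial.aeval_algebraMap_apply (AdjoinRoot g) θ f).symm
  have hnorm : (Algebra.norm ℤ θ : ℚ) = ((-1) ^ f.natDegree * f.coeff 0 : ℤ) := by
    rw [Algebra.coe_norm_int]
    have h1 := Algebra.PowerBasis.norm_gen_eq_coeff_zero_minpoly (AdjoinRoot.powerBasis hQ.ne_zero)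
    rw [AdjoinRoot.powerBasis_dim, AdjoinRoot.powerBasis_gen, hgdeg,
      AdjoinRoot.minpoly_root hQ.ne_zero, hgm.leadingCoeff] at h1
    change Algebra.norm ℚ (AdjoinRoot.root g) = _
    refine Eq.trans ?_ (h1.trans ?_)
    · congr!
    · rw [hg]
      simp
  have hN : ¬ (p : ℤ) ^ 2 ∣ Algebra.norm ℤ θ := by
    rw [Int.cast_injective hnorm, (isUnit_neg_one.pow _).dvd_mul_left]
    have := hE.notMem
    rwa [Ideal.span_singleton_pow, Ideal.mem_span_singleton] at this
  obtain ⟨y, -, hy⟩ := hE.isWeaklyEisensteinAt.exists_mem_adjoin_mul_eq_pow_natDegree hθ hf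
  have hdvd : (p : 𝓞 (AdjoinRoot g)) ∣ θ ^ f.natDegree := by
    rw [hf.natDegree_map] at hy
    exact ⟨y, by rw [← hy]; simp⟩
  exact not_normEuclidean_of_isMaximal hp hdvd hN hq hq'
    (isMaximal_span_natCast_of_irreducible_map hq hf hrank.symm hirr hθ)
    (isMaximal_span_natCast_of_irreducible_map hq' hf hrank.symm hirr' hθ) hrs hr0 hs0
    (by rwa [hrank]) (by rwa [hrank]) (by rwa [hrank])

/-! ### Choice of the primes `p`, `q` and of `p = r + s`. -/

theorem Nat.exists_eq_pow_of_forall_dvd_factorization {n s : ℕ} (hs : s ≠ 0)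
    (h : ∀ q, q.Prime → n ∣ s.factorization q) : ∃ d, s = d ^ n := by
  rcases Nat.eq_zero_or_pos n with rfl | hn
  · refine ⟨1, Nat.eq_of_factorization_eq hs (by simp) fun q => ?_⟩
    by_cases hq : q.Prime
    · simpa using h q hq
    · simp [hq]
  refine ⟨n.floorRoot s, Nat.eq_of_factorization_eq hs
    (pow_ne_zero _ (Nat.floorRoot_ne_zero.mpr ⟨hn.ne', hs⟩)) fun q => ?_⟩
  by_cases hq : q.Prime
  · rw [Nat.factorization_pow, Nat.factorization_floorRoot]
    simp [Nat.floorDiv_eq_div, Nat.mul_div_cancel' (h q hq)]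
  · simp [hq]

/-- For `n ≥ 2` there are arbitrarily large primes modulo which `2` is an `n`-th power. -/
theorem exists_prime_gt_dvd_pow_sub_two {n : ℕ} (hn : 2 ≤ n) (B : ℕ) :
    ∃ p : ℕ, p.Prime ∧ B < p ∧ ∃ c : ℤ, (p : ℤ) ∣ c ^ n - 2 := by
  -- Here `c ^ n - 2 = 2 * (u - 1)` with `c ∣ u`. Every prime up to `B` divides `u`, so a prime
  -- factor of `u - 1` exceeds `B`.
  set c := (B + 3).factorial with hc
  have h3 : 3 ≤ c := by
    calc 3 ≤ B + 3 := by omega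
      _ ≤ c := Nat.self_le_factorial _
  obtain ⟨t, ht⟩ : 2 ∣ c := Nat.dvd_factorial (by norm_num) (by omega)
  have hcn : c ^ n = 2 * (t * c ^ (n - 1)) := by
    rw [← mul_assoc, ← ht, ← pow_succ']
    congr 1
    omega
  have hdvd : c ∣ t * c ^ (n - 1) := (dvd_pow_self c (by omega)).mul_left t
  have hge : c ≤ t * c ^ (n - 1) := Nat.le_of_dvd
    (Nat.mul_pos (by omega) (pow_pos (by omega) _)) hdvd
  set u := t * c ^ (n - 1) with hu
  have hp : (u - 1).minFac.Prime := Nat.minFac_prime (by omega)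
  refine ⟨(u - 1).minFac, hp, ?_, c, ?_⟩
  · by_contra! hle
    have h1 : (u - 1).minFac ∣ u := (Nat.dvd_factorial hp.pos (by omega)).trans hdvd
    have h2 := (Nat.dvd_sub_iff_right (by omega) h1).mp (Nat.minFac_dvd (u - 1))
    exact hp.one_lt.ne' (Nat.dvd_one.mp h2)
  · obtain ⟨v, hv⟩ := Nat.minFac_dvd (u - 1)
    refine ⟨2 * v, ?_⟩
    have hcast : ((c ^ n : ℕ) : ℤ) = 2 * (u : ℤ) := by rw [hcn]; push_cast; ring
    have hv' : ((u - 1 : ℕ) : ℤ) = ((u - 1).minFac : ℤ) * v := by exact_mod_cast hv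
    rw [Nat.cast_sub (by omega)] at hv'
    push_cast at hcast hv'
    rw [hcast]
    linear_combination 2 * hv'

/-- For `n ≥ 2` there are an odd prime `p`, a decomposition `p = r + s` where `r` is an `n`-th
power modulo `p`, and an odd prime `q` such that the exponents of `2` in `r` and of `q` in `s` are
not divisible by `n`. -/
theorem exists_prime_eq_add_not_dvd_factorization {n : ℕ} (hn : 2 ≤ n) :
    ∃ p q r s : ℕ, p.Prime ∧ q.Prime ∧ p ≠ 2 ∧ q ≠ 2 ∧ p ≠ q ∧ r + s = p ∧ 0 < r ∧ 0 < s ∧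
      ¬ n ∣ r.factorization 2 ∧ ¬ n ∣ s.factorization q ∧ ∃ c : ℤ, (p : ℤ) ∣ c ^ n - r := by
  obtain ⟨p, hp, hgt, c, hc⟩ := exists_prime_gt_dvd_pow_sub_two hn (2 ^ (n + 1))
  have h8 : 2 ^ 3 ≤ 2 ^ (n + 1) := Nat.pow_le_pow_right (by norm_num) (by omega)
  have hodd : Odd p := hp.odd_of_ne_two (by omega)
  -- With `r = 2 ^ k`, an `n`-th power modulo `p` because `2` is one, it is enough that `s` is not a
  -- perfect `n`-th power: some prime `q` then has exponent in `s` not divisible by `n`.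
  suffices ∃ k s : ℕ, 0 < k ∧ ¬ n ∣ k ∧ 2 ^ k + s = p ∧ 0 < s ∧ (∀ d, s ≠ d ^ n) by
    obtain ⟨k, s, hk, hnk, hks, hs, hpow⟩ := this
    obtain ⟨q, hq, hqs⟩ : ∃ q, q.Prime ∧ ¬ n ∣ s.factorization q := by
      by_contra! h
      obtain ⟨d, hd⟩ := Nat.exists_eq_pow_of_forall_dvd_factorization hs.ne' h
      exact hpow d hd
    have hqdvd : q ∣ s := by
      by_contra h
      exact hqs (by simp [Nat.factorization_eq_zero_of_not_dvd h])
    have hpos : 0 < 2 ^ k := by positivity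
    refine ⟨p, q, 2 ^ k, s, hp, hq, by omega, ?_, ?_, hks, hpos, hs, ?_, hqs, c ^ k, ?_⟩
    · rintro rfl
      have h2 : 2 ∣ 2 ^ k := dvd_pow_self 2 hk.ne'
      rw [← Nat.not_even_iff_odd, even_iff_two_dvd, ← hks] at hodd
      exact hodd (dvd_add h2 hqdvd)
    · rintro rfl
      have := Nat.le_of_dvd hs hqdvd
      omega
    · simpa [Nat.Prime.factorization_self Nat.prime_two] using hnk
    · rw [← pow_mul, mul_comm, pow_mul]
      push_cast
      exact hc.trans (sub_dvd_pow_sub_pow _ _ k)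
  -- One of `k = 1` and `k = n + 1` works. Otherwise `p - 2 = d ^ n` and `p - 2 ^ (n + 1) = e ^ n`
  -- with `d > e` both odd, so `d ≥ e + 2` and `d ^ n - e ^ n ≥ 2 ^ (n + 1)`, whereas the difference
  -- is `2 ^ (n + 1) - 2`.
  by_cases h1 : ∀ d, p - 2 ≠ d ^ n
  · exact ⟨1, p - 2, one_pos, fun h => by have := Nat.le_of_dvd one_pos h; omega, by omega,
      by omega, h1⟩
  push Not at h1
  obtain ⟨d, hd⟩ := h1
  refine ⟨n + 1, p - 2 ^ (n + 1), by omega, ?_, by omega, by omega, fun e he => ?_⟩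
  · rw [Nat.dvd_add_right dvd_rfl]
    intro h
    have := Nat.le_of_dvd one_pos h
    omega
  have hev : 2 ∣ 2 ^ (n + 1) := dvd_pow_self 2 (by omega)
  have hdodd : ¬ 2 ∣ d := fun h => by
    have : 2 ∣ d ^ n := dvd_pow h (by omega)
    rw [← hd] at this
    rcases hodd with ⟨m, rfl⟩
    omega
  have heodd : ¬ 2 ∣ e := fun h => by
    have : 2 ∣ e ^ n := dvd_pow h (by omega)
    rw [← he] at this
    rcases hodd with ⟨m, rfl⟩
    omega
  have hlt : e < d := lt_of_pow_lt_pow_left₀ n (by omega) (by omega)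
  obtain ⟨j, rfl⟩ : ∃ j, d = e + 2 + j := ⟨d - e - 2, by omega⟩
  have he1 : 1 ≤ e := by omega
  have key : ∀ m, 2 ≤ m → e ^ m + 2 ^ (m + 1) ≤ (e + 2) ^ m := by
    intro m hm
    induction m, hm using Nat.le_induction with
    | base => norm_num; nlinarith
    | succ m hm ih =>
      have h5 := Nat.mul_le_mul_right (e + 2) ih
      rw [← pow_succ] at h5
      calc
        e ^ (m + 1) + 2 ^ (m + 1 + 1) ≤ (e ^ m + 2 ^ (m + 1)) * (e + 2) := by
          rw [pow_succ e m, pow_succ 2 (m + 1)]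
          nlinarith [Nat.zero_le (2 ^ (m + 1) * e), Nat.zero_le (e ^ m)]
        _ ≤ _ := h5
  have h3 := key n hn
  have h4 : (e + 2) ^ n ≤ (e + 2 + j) ^ n := Nat.pow_le_pow_left (by omega) n
  omega

/-! ### The residue class, by the Chinese remainder theorem. -/

theorem exists_monic_irreducible_natDegree_eq (q : ℕ) [Fact q.Prime] {n : ℕ} (hn : n ≠ 0) :
    ∃ h : (ZMod q)[X], h.Monic ∧ Irreducible h ∧ h.natDegree = n := by
  let pb := Field.powerBasisOfFiniteOfSeparable (ZMod q) (GaloisField q n)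
  refine ⟨minpoly (ZMod q) pb.gen, minpoly.monic pb.isIntegral_gen,
    minpoly.irreducible pb.isIntegral_gen, ?_⟩
  rw [pb.natDegree_minpoly, ← pb.finrank, GaloisField.finrank q hn]

theorem Int.exists_dvd_sub_and_dvd_sub {a b : ℤ} (hab : IsCoprime a b) (x y : ℤ) :
    ∃ w, a ∣ w - x ∧ b ∣ w - y := by
  obtain ⟨u, v, huv⟩ := hab
  exact ⟨x * (v * b) + y * (u * a), ⟨u * (y - x), by linear_combination x * huv⟩,
    ⟨v * (x - y), by linear_combination y * huv⟩⟩

theorem map_castRingHom_eq_of_dvd_coeff_sub {q n : ℕ} {f : ℤ[X]} (hf : f.Monic)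
    (hdeg : f.natDegree = n) {h : (ZMod q)[X]} (hh : h.Monic) (hhdeg : h.natDegree = n)
    {b : ℕ → ℤ} (hb : ∀ i, (b i : ZMod q) = h.coeff i)
    (hfb : ∀ i < n, (q : ℤ) ∣ f.coeff i - b i) : f.map (Int.castRingHom (ZMod q)) = h := by
  ext i
  rw [coeff_map, eq_intCast]
  rcases lt_trichotomy i n with hi | rfl | hi
  · rw [← hb, ← sub_eq_zero, ← Int.cast_sub]
    exact (ZMod.intCast_zmod_eq_zero_iff_dvd _ _).mpr (hfb i hi)
  · nth_rewrite 1 [← hdeg]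
    rw [hf.coeff_natDegree, ← hhdeg, hh.coeff_natDegree, Int.cast_one]
  · rw [coeff_eq_zero_of_natDegree_lt (hdeg.trans_lt hi),
      coeff_eq_zero_of_natDegree_lt (hhdeg.trans_lt hi), Int.cast_zero]

/-- There is a residue class of monic polynomials of degree `n` all of which are Eisenstein and
generate fields that are not norm-Euclidean. -/
theorem exists_residue_class_generatesNonNormEuclideanField {n : ℕ} (hn : 2 ≤ n) :
    ∃ (M : ℕ) (b : ℕ → ℤ), 0 < M ∧ ∀ f : ℤ[X], f.Monic → f.natDegree = n →
      (∀ i < n, (M : ℤ) ∣ f.coeff i - b i) →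
      IsEisensteinPoly f ∧ GeneratesNonNormEuclideanField f := by
  obtain ⟨p, q, r, s, hp, hq, hp2, hq2, hpq, hrs, hr0, hs0, hr, hs, c, hc⟩ :=
    exists_prime_eq_add_not_dvd_factorization hn
  have := Fact.mk hq
  obtain ⟨g, hgm, hgirr, hgdeg⟩ := exists_monic_irreducible_natDegree_eq 2 (n := n) (by omega)
  obtain ⟨h, hhm, hhirr, hhdeg⟩ := exists_monic_irreducible_natDegree_eq q (n := n) (by omega)
  choose x hx using fun i => ZMod.intCast_surjective (g.coeff i)
  choose y hy using fun i => ZMod.intCast_surjective (h.coeff i)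
  have hcop : IsCoprime ((2 : ℕ) : ℤ) (q : ℤ) :=
    Nat.isCoprime_iff_coprime.mpr ((Nat.coprime_primes Nat.prime_two hq).mpr hq2.symm)
  have hcop' : IsCoprime ((p : ℤ) ^ 2) (((2 : ℕ) : ℤ) * q) := IsCoprime.pow_left <|
    IsCoprime.mul_right
      (Nat.isCoprime_iff_coprime.mpr ((Nat.coprime_primes hp Nat.prime_two).mpr hp2))
      (Nat.isCoprime_iff_coprime.mpr ((Nat.coprime_primes hp hq).mpr hpq))
  choose z hzx hzy using fun i => Int.exists_dvd_sub_and_dvd_sub hcop (x i) (y i)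
  -- The class is that of `X ^ n + p` modulo `p ^ 2`, of `g` modulo `2` and of `h` modulo `q`.
  choose b hbp hbz using fun i =>
    Int.exists_dvd_sub_and_dvd_sub hcop' (if i = 0 then (p : ℤ) else 0) (z i)
  refine ⟨p ^ 2 * (2 * q), b, Nat.mul_pos (pow_pos hp.pos 2) (Nat.mul_pos two_pos hq.pos),
    fun f hf hdeg hfb => ?_⟩
  have hfp : ∀ i < n, (p : ℤ) ^ 2 ∣ f.coeff i - if i = 0 then (p : ℤ) else 0 := fun i hi => by
    have h1 : (p : ℤ) ^ 2 ∣ f.coeff i - b i :=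
      (Dvd.intro ((2 : ℤ) * q) (by push_cast; ring)).trans (hfb i hi)
    simpa using dvd_add h1 (hbp i)
  have hfz : ∀ i < n, ((2 : ℕ) : ℤ) * q ∣ f.coeff i - z i := fun i hi => by
    have h1 : ((2 : ℕ) : ℤ) * q ∣ f.coeff i - b i :=
      (Dvd.intro_left ((p : ℤ) ^ 2) (by push_cast; ring)).trans (hfb i hi)
    simpa using dvd_add h1 (hbz i)
  have hf2 : f.map (Int.castRingHom (ZMod 2)) = g :=
    map_castRingHom_eq_of_dvd_coeff_sub hf hdeg hgm hgdeg hx fun i hi => by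
      simpa using dvd_add ((Dvd.intro _ rfl).trans (hfz i hi)) (hzx i)
  have hfq : f.map (Int.castRingHom (ZMod q)) = h :=
    map_castRingHom_eq_of_dvd_coeff_sub hf hdeg hhm hhdeg hy fun i hi => by
      simpa using dvd_add ((Dvd.intro_left _ rfl).trans (hfz i hi)) (hzy i)
  have hprime : (Ideal.span {(p : ℤ)}).IsPrime :=
    (Ideal.span_singleton_prime (by exact_mod_cast hp.ne_zero)).mpr (Nat.prime_iff_prime_int.mp hp)
  have hE : f.IsEisensteinAt (Ideal.span {(p : ℤ)}) := by
    refine hf.isEisensteinAt_of_mem_of_notMem hprime.ne_top (fun {i} hi => ?_) ?_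
    · rw [Ideal.mem_span_singleton]
      have h1 := (dvd_pow_self (p : ℤ) two_ne_zero).trans (hfp i (hdeg ▸ hi))
      have h2 : (p : ℤ) ∣ if i = 0 then (p : ℤ) else 0 := by split_ifs <;> simp
      simpa using dvd_add h1 h2
    · rw [Ideal.span_singleton_pow, Ideal.mem_span_singleton]
      intro h1
      have h2 := dvd_sub h1 (hfp 0 (by omega))
      rw [if_pos rfl, sub_sub_cancel, pow_two] at h2
      have hp0 : (p : ℤ) ≠ 0 := by exact_mod_cast hp.ne_zero
      have h3 : (p : ℤ) ∣ 1 := (mul_dvd_mul_iff_left hp0).mp (by simpa using h2)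
      exact hp.one_lt.ne' (by exact_mod_cast Int.eq_one_of_dvd_one (by positivity) h3)
  exact ⟨⟨p, hp, hE⟩, generatesNonNormEuclideanField_of_isEisensteinAt hf (by omega) hp
    Nat.prime_two hq hE (hf2 ▸ hgirr) (hfq ▸ hhirr) hrs hr0 hs0 (hdeg ▸ hr) (hdeg ▸ hs)
    (hdeg ▸ hc)⟩

/-! ### Counting by height and lower density. -/

theorem Polynomial.supNorm_le_iff {f : ℤ[X]} {X : ℝ} :
    f.supNorm ≤ X ↔ ∀ i, |(f.coeff i : ℝ)| ≤ X := by
  constructor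
  · intro h i
    rw [← Int.norm_eq_abs]
    exact (f.le_supNorm i).trans h
  · intro h
    obtain ⟨i, hi⟩ := f.exists_eq_supNorm
    rw [hi, Int.norm_eq_abs]
    exact h i

/-- The monic polynomial of degree `n` with prescribed lower coefficients. -/
noncomputable def monicOfCoeffs {n : ℕ} (a : Fin n → ℤ) : ℤ[X] :=
  X ^ n + ∑ i : Fin n, C (a i) * X ^ (i : ℕ)

theorem degree_sum_C_mul_X_pow_lt {n : ℕ} (a : Fin n → ℤ) :
    (∑ i : Fin n, C (a i) * X ^ (i : ℕ)).degree < (n : WithBot ℕ) :=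
  degree_sum_fin_lt a

theorem monic_monicOfCoeffs {n : ℕ} (a : Fin n → ℤ) : (monicOfCoeffs a).Monic :=
  monic_X_pow_add (degree_sum_C_mul_X_pow_lt a)

theorem natDegree_monicOfCoeffs {n : ℕ} (a : Fin n → ℤ) : (monicOfCoeffs a).natDegree = n :=
  natDegree_eq_of_degree_eq_some <| by
    rw [monicOfCoeffs, degree_add_eq_left_of_degree_lt, degree_X_pow]
    rw [degree_X_pow]
    exact degree_sum_C_mul_X_pow_lt a

theorem coeff_monicOfCoeffs {n : ℕ} (a : Fin n → ℤ) (i : Fin n) :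
    (monicOfCoeffs a).coeff i = a i := by
  rw [monicOfCoeffs, coeff_add, coeff_X_pow, if_neg i.isLt.ne, zero_add, finsetSum_coeff]
  simp [coeff_X_pow, Fin.val_inj]

theorem ext_of_monic_of_natDegree_eq {n : ℕ} {f g : ℤ[X]} (hf : f.Monic) (hg : g.Monic)
    (hfn : f.natDegree = n) (hgn : g.natDegree = n) (h : ∀ i < n, f.coeff i = g.coeff i) :
    f = g := by
  ext i
  rcases lt_trichotomy i n with hi | rfl | hi
  · exact h i hi
  · nth_rewrite 1 [← hfn]
    rw [hf.coeff_natDegree, ← hgn, hg.coeff_natDegree]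
  · rw [coeff_eq_zero_of_natDegree_lt (hfn.trans_lt hi),
      coeff_eq_zero_of_natDegree_lt (hgn.trans_lt hi)]

section Counting

variable {n : ℕ} {F : Set ℤ[X]}

theorem injOn_coeff_of_monic_natDegree_eq (hF : ∀ f ∈ F, f.Monic ∧ f.natDegree = n)
    (X : ℝ) :
    Set.InjOn (fun (f : ℤ[X]) (i : Fin n) => f.coeff i) {f | f ∈ F ∧ f.supNorm ≤ X} :=
  fun f hf g hg hfg => ext_of_monic_of_natDegree_eq (hF f hf.1).1 (hF g hg.1).1 (hF f hf.1).2
    (hF g hg.1).2 fun i hi => congrFun hfg ⟨i, hi⟩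

theorem coeff_mem_Icc_of_supNorm_le {f : ℤ[X]} {X : ℝ} (hf : f.supNorm ≤ X) :
    (fun i : Fin n => f.coeff i) ∈
      Fintype.piFinset fun _ : Fin n => Finset.Icc (-(⌊X⌋₊ : ℤ)) ⌊X⌋₊ := by
  rw [Fintype.mem_piFinset]
  intro i
  have h := Polynomial.supNorm_le_iff.mp hf i
  have h1 : (f.coeff i).natAbs ≤ ⌊X⌋₊ := Nat.le_floor (by rwa [Nat.cast_natAbs, Int.cast_abs])
  rw [Finset.mem_Icc]
  omega

theorem finite_setOf_supNorm_le (hF : ∀ f ∈ F, f.Monic ∧ f.natDegree = n) (X : ℝ) :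
    {f | f ∈ F ∧ f.supNorm ≤ X}.Finite :=
  Set.Finite.of_injOn (fun _ hf => coeff_mem_Icc_of_supNorm_le hf.2)
    (injOn_coeff_of_monic_natDegree_eq hF X)
    (Fintype.piFinset fun _ : Fin n => Finset.Icc (-(⌊X⌋₊ : ℤ)) ⌊X⌋₊).finite_toSet

theorem countHeightLE_le (hF : ∀ f ∈ F, f.Monic ∧ f.natDegree = n) (X : ℝ) :
    countHeightLE F X ≤ (2 * ⌊X⌋₊ + 1) ^ n := by
  have h := Set.ncard_le_ncard_of_injOn _
    (fun f (hf : f ∈ {f | f ∈ F ∧ f.supNorm ≤ X}) => coeff_mem_Icc_of_supNorm_le hf.2)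
    (injOn_coeff_of_monic_natDegree_eq hF X)
    (Fintype.piFinset fun _ : Fin n => Finset.Icc (-(⌊X⌋₊ : ℤ)) ⌊X⌋₊).finite_toSet
  refine h.trans ?_
  rw [Set.ncard_coe_finset, Fintype.card_piFinset_const, Int.card_Icc]
  exact Nat.pow_le_pow_left (by omega) _

/-- A set of monic polynomials of degree `n` which contains a residue class modulo `M` has at least
`⌊X / M⌋ ^ n` elements of height at most `X`. -/
theorem pow_le_countHeightLE (hF : ∀ f ∈ F, f.Monic ∧ f.natDegree = n)
    {M : ℕ} (hM : 0 < M) (b : ℕ → ℤ)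
    (hb : ∀ f : ℤ[X], f.Monic → f.natDegree = n → (∀ i < n, (M : ℤ) ∣ f.coeff i - b i) → f ∈ F)
    {X : ℝ} (hX : 1 ≤ X) : (⌊X⌋₊ / M) ^ n ≤ countHeightLE F X := by
  have hM0 : (0 : ℤ) < M := by exact_mod_cast hM
  set N := ⌊X⌋₊
  -- Each lower coefficient runs through the `N / M` representatives of its class in `[0, M * (N /
  -- M))`.
  let φ : (Fin n → Fin (N / M)) → ℤ[X] := fun t =>
    monicOfCoeffs fun i => b i % M + M * (t i : ℕ)
  have hφ : Function.Injective φ := fun t t' h => by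
    ext i
    have h1 := congrArg (fun f : ℤ[X] => f.coeff i) h
    simp only [φ, coeff_monicOfCoeffs] at h1
    have h2 : (M : ℤ) * (t i : ℕ) = M * (t' i : ℕ) := by linarith
    exact_mod_cast mul_left_cancel₀ hM0.ne' h2
  have hcard : (Set.range φ).ncard = (N / M) ^ n := by
    rw [← Set.image_univ, Set.ncard_image_of_injective _ hφ, Set.ncard_univ]
    simp
  rw [← hcard]
  refine Set.ncard_le_ncard ?_ (finite_setOf_supNorm_le hF X)
  rintro _ ⟨t, rfl⟩
  have hm := monic_monicOfCoeffs fun i : Fin n => b i % M + M * (t i : ℕ)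
  have hd := natDegree_monicOfCoeffs fun i : Fin n => b i % M + M * (t i : ℕ)
  refine ⟨hb _ hm hd fun i hi => ?_, Polynomial.supNorm_le_iff.mpr fun i => ?_⟩
  · have := coeff_monicOfCoeffs (fun i : Fin n => b i % M + M * (t i : ℕ)) ⟨i, hi⟩
    rw [this]
    have h1 : b i % M + M * (t ⟨i, hi⟩ : ℕ) - b i = M * ((t ⟨i, hi⟩ : ℕ) - b i / M) := by
      linear_combination Int.emod_add_mul_ediv (b i) M
    exact ⟨_, h1⟩
  · rcases lt_trichotomy i n with hi | rfl | hi
    · have := coeff_monicOfCoeffs (fun i : Fin n => b i % M + M * (t i : ℕ)) ⟨i, hi⟩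
      rw [this]
      have h0 := Int.emod_nonneg (b i) hM0.ne'
      have h1 := Int.emod_lt_of_pos (b i) hM0
      have h2 : M * ((t ⟨i, hi⟩ : ℕ) + 1) ≤ N :=
        (Nat.mul_le_mul_left M (t ⟨i, hi⟩).isLt).trans (Nat.mul_div_le N M)
      have h3 : ((M * ((t ⟨i, hi⟩ : ℕ) + 1) : ℕ) : ℤ) ≤ N := by exact_mod_cast h2
      push_cast at h3
      have h4 : |b i % M + M * ((t ⟨i, hi⟩ : ℕ) : ℤ)| ≤ N := by
        rw [abs_of_nonneg (by positivity)]
        linarith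
      calc _ ≤ (N : ℝ) := by exact_mod_cast h4
        _ ≤ X := Nat.floor_le (by linarith)
    · have : (φ t).coeff i = 1 := by
        have h := hm.coeff_natDegree
        rwa [hd] at h
      rw [this]
      simpa using hX
    · rw [coeff_eq_zero_of_natDegree_lt (hd.trans_lt hi)]
      simp only [Int.cast_zero, abs_zero]
      linarith

end Counting

/-- A property of all polynomials in a residue class has positive lower density. -/
theorem lowerDensity_pos_of_residue_class {n : ℕ} {F : Set ℤ[X]} {P : ℤ[X] → Prop}
    (hF : ∀ f ∈ F, f.Monic ∧ f.natDegree = n) {M : ℕ} (hM : 0 < M) (b : ℕ → ℤ)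
    (hb : ∀ f : ℤ[X], f.Monic → f.natDegree = n → (∀ i < n, (M : ℤ) ∣ f.coeff i - b i) →
      f ∈ F ∧ P f) : 0 < lowerDensity F P := by
  have hFP : ∀ f ∈ {f | f ∈ F ∧ P f}, f.Monic ∧ f.natDegree = n := fun f hf => hF f hf.1
  have hle : ∀ X : ℝ, countHeightLE {f | f ∈ F ∧ P f} X ≤ countHeightLE F X :=
    fun X => Set.ncard_le_ncard (fun f hf => ⟨hf.1.1, hf.2⟩) (finite_setOf_supNorm_le hF X)
  have hM0 : (0 : ℝ) < M := by exact_mod_cast hM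
  -- With `N = ⌊X⌋₊` and `k = N / M ≥ 1`, one has `N < M * (k + 1) ≤ 2 * M * k`, so `2 * N + 1 ≤ 6 *
  -- M * k` with room to spare.
  have hpos : (0 : ℝ) < (1 / (6 * M)) ^ n := by positivity
  refine hpos.trans_le (le_liminf_of_le ?_ ?_)
  -- A real `liminf` is meaningful only with a bound from above; proportions are at most `1`.
  · refine IsBoundedUnder.isCoboundedUnder_ge ⟨1, ?_⟩
    rw [eventually_map]
    exact Eventually.of_forall fun X =>
      div_le_one_of_le₀ (by exact_mod_cast hle X) (Nat.cast_nonneg _)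
  · filter_upwards [eventually_ge_atTop (M : ℝ), eventually_ge_atTop 1] with X hXM hX1
    have hMN : M ≤ ⌊X⌋₊ := Nat.le_floor hXM
    have hnum := pow_le_countHeightLE hFP hM b hb hX1
    have hden := countHeightLE_le hF X
    have hk : 0 < ⌊X⌋₊ / M := Nat.div_pos hMN hM
    have hpos' : 0 < countHeightLE F X := (pow_pos hk n).trans_le (hnum.trans (hle X))
    have h1 : 2 * ⌊X⌋₊ + 1 ≤ 6 * M * (⌊X⌋₊ / M) := by
      have h2 := Nat.div_add_mod ⌊X⌋₊ M
      have h3 := Nat.mod_lt ⌊X⌋₊ hM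
      have h4 : M * 1 ≤ M * (⌊X⌋₊ / M) := Nat.mul_le_mul_left M hk
      rw [mul_assoc]
      omega
    have h2 : ((2 * ⌊X⌋₊ + 1 : ℕ) : ℝ) ≤ ((6 * M * (⌊X⌋₊ / M) : ℕ) : ℝ) := by exact_mod_cast h1
    rw [proportionHeightLE, le_div_iff₀ (by exact_mod_cast hpos')]
    calc (1 / (6 * M : ℝ)) ^ n * countHeightLE F X
        ≤ (1 / (6 * M : ℝ)) ^ n * ((2 * ⌊X⌋₊ + 1 : ℕ) : ℝ) ^ n := by
          gcongr
          exact_mod_cast hden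
      _ ≤ (1 / (6 * M : ℝ)) ^ n * ((6 * M * (⌊X⌋₊ / M) : ℕ) : ℝ) ^ n := by gcongr
      _ = (((⌊X⌋₊ / M : ℕ)) : ℝ) ^ n := by
          rw [← mul_pow, Nat.cast_mul, Nat.cast_mul, Nat.cast_ofNat, ← mul_assoc,
            one_div_mul_cancel (by positivity), one_mul]
      _ ≤ _ := by exact_mod_cast hnum

theorem corollary1 (n : ℕ) (hn : 2 ≤ n) :
    0 < lowerDensity (monicEisenstein n) GeneratesNonNormEuclideanField := by
  obtain ⟨M, b, hM, hb⟩ := exists_residue_class_generatesNonNormEuclideanField hn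
  exact lowerDensity_pos_of_residue_class (fun f hf => ⟨hf.1, hf.2.1⟩) hM b fun f hf hdeg hfb =>
    ⟨⟨hf, hdeg, (hb f hf hdeg hfb).1⟩, (hb f hf hdeg hfb).2⟩
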